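/- A standard Borel probability space is a standard Borel space $\Omega$ (a Borel subset of a Polish space with its Borel $\sigma$-algebra) with a probability measure $P_\Omega$. Fix a family of standard Borel probability spaces that contains every such space up to (measure-preserving measurable) isomorphism, and let $\mathbb{SBP}_0$ be the category whose objects are the members of the family and whose morphisms are the equivalence classes $[p]$ of measure-preserving measurable maps modulo almost-sure equality. A *disintegration* of a random variable $X\colon\Omega\to A$ (with law $P_X$, and $A$ standard Borel) is a Markov kernel $x\mapsto P_\Omega(-\mid X=x)$ from $A$ to $\Omega$ with $P_\Omega(X^{-1}(x)\mid X=x)=1$ for $P_X$-almost all $x$ and $P_\Omega(S)=\int_A P_\Omega(S\mid X=x)\,dP_X(x)$ for every measurable $S\subseteq\Omega$. Random variables $X\colon\Omega\to A$, $Y\colon\Omega\to B$ are *conditionally independent given* $Z\colon\Omega\to C$ (written $X\perp Y\mid Z$) if for all measurable $S\subseteq A$, $T\subseteq B$ and $P_Z$-almost all $z$, $$P_\Omega(X^{-1}(S)\cap Y^{-1}(T)\mid Z=z)=P_\Omega(X^{-1}(S)\mid Z=z)\cdot P_\Omega(Y^{-1}(T)\mid Z=z).$$ Given a collection of commuting squares,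 called independent squares, in a category, with legs $f\colon X\to Y$, $g\colon X\to Z$ and cospan $u\colon Y\to W$, $v\colon Z\to W$ (so $uf=vg$), a square $(f,g,u,v)$ is an *independent pullback* if it is independent and for every independent square $(f',g',u,v)$ with vertex $X'$ there is a unique $q\colon X'\to X$ with $fq=f'$ and $gq=g'$. The collection is an *independent-pullback structure* if: 1. for all $f\colon X\to Y$ and $g\colon Y\to Z$ the square $(gf,f,\mathrm{id}_Z,g)$ is independent; 2. if $(f,g,u,v)$ is independent, so is $(g,f,v,u)$; 3. if the squares $(A)=(l,a,b,m)$ and $(B)=(m,c,d,n)$ are independent, so is the composite rectangle $(AB)=(l,ca,db,n)$; 4. if $(A)$ and $(B)$ commute, $(AB)$ is independent and $(B)$ is an independent pullback, then $(A)$ is independent; 5. every cospan $(u,v)$ can be completed to an independent pullback $(f,g,u,v)$. It has the *descent property* if, whenever $(f,g,u,v)$ is a commuting square and $(fq,gq,u,v)$ is independent for some map $q$ into the vertex of the square, $(f,g,u,v)$ is independent. A *pair factorisation* of a span $Y\xleftarrow{f}X\xrightarrow{g}Z$ consists of maps $q'\colon X\to X'$, $f'\colon X'\to Y$, $g'\colon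 X'\to Z$ with $f'q'=f$, $g'q'=g$. A morphism of pair factorisations $(X',q',f',g')\to(X'',q'',f'',g'')$ is a map $r\colon X'\to X''$ with $rq'=q''$, $f''r=f'$, $g''r=g'$. A *pairing* of $f,g$ is a terminal pair factorisation, and a category *has pairings* if every span has one. **Proposition.** Declare a commuting square $([p],[q],[r],[s])$ in $\mathbb{SBP}_0$ independent if $p\perp q\mid r\circ p$. This does not depend on the representatives $p,q,r,s$, and it defines an independent-pullback structure on $\mathbb{SBP}_0$ that satisfies the descent property. For every cospan $\Omega_Y\xrightarrow{[r]}\Omega_W\xleftarrow{[s]}\Omega_Z$ and all disintegrations of $r$ and $s$, an independent pullback is given by (any object of $\mathbb{SBP}_0$ isomorphic to) the product $\Omega_Y\times\Omega_Z$ with the measure $$U\mapsto\int_{\Omega_W}\bigl(P_{\Omega_Y}(-\mid r=\omega)\otimes P_{\Omega_Z}(-\mid s=\omega)\bigr)(U)\,dP_{\Omega_W}(\omega),$$ together with the two projections. Moreover $\mathbb{SBP}_0$ has pairings: a pairing of a span $\Omega_Y\xleftarrow{[p]}\Omega_X\xrightarrow{[q]}\Omega_Z$ is given by (any object of $\mathbb{SBP}_0$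 isomorphic to) $\Omega_Y\times\Omega_Z$ with the joint law of $(p,q)$, the map $[(p,q)]$ and the two projections. -/

import Mathlib

open CategoryTheory MeasureTheory ProbabilityTheory

universe v u w

/-! ### Independent pullbacks and pairings in a category -/

section General

variable {C : Type u} [Category.{v} C]

/-- A collection of commuting squares of `C`, called the independent squares.
`Indep f g u v` says that the square with top-left corner `X`, legs `f : X ⟶ Y`, `g : X ⟶ Z`
and cospan `u : Y ⟶ W`, `v : Z ⟶ W` is independent:
```
    X --g--> Z
    |f       |v
    Y --u--> W
```
-/
structure IndependentSquares (C : Type u) [Category.{v} C] where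
  Indep : ∀ {X Y Z W : C}, (X ⟶ Y) → (X ⟶ Z) → (Y ⟶ W) → (Z ⟶ W) → Prop
  comm : ∀ {X Y Z W : C} {f : X ⟶ Y} {g : X ⟶ Z} {u : Y ⟶ W} {v : Z ⟶ W},
    Indep f g u v → f ≫ u = g ≫ v

/-- An independent square which has the universal property of a pullback with respect to
independent squares. -/
def IndependentSquares.IsIndependentPullback (S : IndependentSquares C) {X Y Z W : C}
    (f : X ⟶ Y) (g : X ⟶ Z) (u : Y ⟶ W) (v : Z ⟶ W) : Prop :=
  S.Indep f g u v ∧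
    ∀ (X' : C) (f' : X' ⟶ Y) (g' : X' ⟶ Z), S.Indep f' g' u v →
      ∃! q : X' ⟶ X, q ≫ f = f' ∧ q ≫ g = g'

/-- The axioms of a system of independent pullbacks.  In `ip3` and `ip4` the diagram is
```
    X --a--> X₁ --c--> X₂
    |l  (A)  |m  (B)   |n
    Y --b--> Y₁ --d--> Y₂
```
-/
structure IndependentSquares.IsIndependentPullbackStructure (S : IndependentSquares C) :
    Prop where
  /-- The square with top `f`, right side `g`, left side the composite and bottom `𝟙 Z` is
  independent. -/
  ip1 : ∀ {X Y Z : C} (f : X ⟶ Y) (g : Y ⟶ Z), S.Indep (f ≫ g) f (𝟙 Z) g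
  /-- Independence is invariant under transposing the square. -/
  ip2 : ∀ {X Y Z W : C} (f : X ⟶ Y) (g : X ⟶ Z) (u : Y ⟶ W) (v : Z ⟶ W),
    S.Indep f g u v → S.Indep g f v u
  /-- If (A) and (B) are independent, then so is the composite rectangle. -/
  ip3 : ∀ {X X₁ X₂ Y Y₁ Y₂ : C} (a : X ⟶ X₁) (c : X₁ ⟶ X₂) (l : X ⟶ Y) (m : X₁ ⟶ Y₁)
    (n : X₂ ⟶ Y₂) (b : Y ⟶ Y₁) (d : Y₁ ⟶ Y₂),
    S.Indep l a b m → S.Indep m c d n → S.Indep l (a ≫ c) (b ≫ d) n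
  /-- If the rectangle is independent and (B) is an independent pullback, then (A) is
  independent. -/
  ip4 : ∀ {X X₁ X₂ Y Y₁ Y₂ : C} (a : X ⟶ X₁) (c : X₁ ⟶ X₂) (l : X ⟶ Y) (m : X₁ ⟶ Y₁)
    (n : X₂ ⟶ Y₂) (b : Y ⟶ Y₁) (d : Y₁ ⟶ Y₂), l ≫ b = a ≫ m →
    S.Indep l (a ≫ c) (b ≫ d) n → S.IsIndependentPullback m c d n → S.Indep l a b m
  /-- Every cospan can be completed to an independent pullback. -/
  ip5 : ∀ {Y Z W : C} (u : Y ⟶ W) (v : Z ⟶ W),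
    ∃ (X : C) (f : X ⟶ Y) (g : X ⟶ Z), S.IsIndependentPullback f g u v

/-- The descent property: a commuting square is independent as soon as some square obtained
from it by precomposing both legs with a map `q` is independent. -/
def IndependentSquares.HasDescent (S : IndependentSquares C) : Prop :=
  ∀ {X' X Y Z W : C} (q : X' ⟶ X) (f : X ⟶ Y) (g : X ⟶ Z) (u : Y ⟶ W) (v : Z ⟶ W),
    f ≫ u = g ≫ v → S.Indep (q ≫ f) (q ≫ g) u v → S.Indep f g u v

/-- A pair factorisation of a span `Y ⟵ X ⟶ Z`. -/
structure PairFactorisation {X Y Z : C} (f : X ⟶ Y) (g : X ⟶ Z) where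
  pt : C
  map : X ⟶ pt
  fst : pt ⟶ Y
  snd : pt ⟶ Z
  map_fst : map ≫ fst = f
  map_snd : map ≫ snd = g

/-- A pair factorisation is a pairing if it is terminal among pair factorisations. -/
def PairFactorisation.IsPairing {X Y Z : C} {f : X ⟶ Y} {g : X ⟶ Z}
    (T : PairFactorisation f g) : Prop :=
  ∀ F : PairFactorisation f g,
    ∃! r : F.pt ⟶ T.pt, F.map ≫ r = T.map ∧ r ≫ T.fst = F.fst ∧ r ≫ T.snd = F.snd

/-- Every span has a pairing. -/
def HasPairings (C : Type u) [Category.{v} C] : Prop :=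
  ∀ {X Y Z : C} (f : X ⟶ Y) (g : X ⟶ Z), ∃ T : PairFactorisation f g, T.IsPairing

end General

/-! ### Disintegrations and conditional independence -/

section Disintegration

variable {Ω : Type*} [MeasurableSpace Ω]

/-- `D` is a disintegration of the random variable `X : Ω → A` on `(Ω, P)`: a Markov kernel,
`D x S` being the conditional probability `P (S ∣ X = x)`. -/
structure IsDisintegration {A : Type*} [MeasurableSpace A] (P : Measure Ω) (X : Ω → A)
    (D : Kernel A Ω) : Prop where
  markov : IsMarkovKernel D
  fibre : ∀ᵐ x ∂(P.map X), D x (X ⁻¹' {x}) = 1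
  total : ∀ S : Set Ω, MeasurableSet S → P S = ∫⁻ x, D x S ∂(P.map X)

/-- Random variables have disintegrations. -/
theorem exists_isDisintegration [StandardBorelSpace Ω] {A : Type*} [MeasurableSpace A]
    [StandardBorelSpace A] (P : Measure Ω) [IsProbabilityMeasure P] {X : Ω → A}
    (hX : Measurable X) : ∃ D : Kernel A Ω, IsDisintegration P X D := by
  have : Nonempty Ω := P.nonempty_of_neZero
  have hD := compProd_map_condDistrib (mβ := inferInstance) (μ := P) (X := X)
    (Y := (id : Ω → Ω)) aemeasurable_id
  have hpm : IsProbabilityMeasure (P.map X) := Measure.isProbabilityMeasure_map hX.aemeasurable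
  refine ⟨condDistrib id X P, inferInstance, ?_, fun S hS => ?_⟩
  · have hmeas : MeasurableSet {z : A × Ω | X z.2 = z.1} :=
      measurableSet_eq_fun (hX.comp measurable_snd) measurable_fst
    have h1 : ∀ᵐ z ∂((P.map X) ⊗ₘ condDistrib id X P), X z.2 = z.1 := by
      rw [hD]
      refine (ae_map_iff (hX.prodMk measurable_id).aemeasurable hmeas).2 ?_
      exact Filter.Eventually.of_forall fun ω => rfl
    have h2 := Measure.ae_ae_of_ae_compProd h1
    filter_upwards [h2] with x hx
    exact (prob_compl_eq_zero_iff (hX (measurableSet_singleton x))).1 hx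
  · have h := congrArg (fun ν => ν (Set.univ ×ˢ S)) hD
    simp only [Measure.compProd_apply_prod MeasurableSet.univ hS, Measure.restrict_univ] at h
    rw [h, Measure.map_apply (hX.prodMk measurable_id) (MeasurableSet.univ.prod hS)]
    congr 1
    ext ω
    simp

/-- `X` and `Y` are conditionally independent given `Z`, on `(Ω, P)`.  Disintegrations exist
and are unique up to almost-sure equality, so it does not matter which one is used. -/
def CondIndepRV {A B C : Type*} [MeasurableSpace A] [MeasurableSpace B] [MeasurableSpace C]
    (P : Measure Ω) (X : Ω → A) (Y : Ω → B) (Z : Ω → C) : Prop :=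
  ∃ D : Kernel C Ω, IsDisintegration P Z D ∧
    ∀ (S : Set A) (T : Set B), MeasurableSet S → MeasurableSet T →
      ∀ᵐ z ∂(P.map Z), D z (X ⁻¹' S ∩ Y ⁻¹' T) = D z (X ⁻¹' S) * D z (Y ⁻¹' T)

end Disintegration

/-! ### Standard Borel probability spaces -/

/-- A standard Borel probability space. -/
structure SBPS where
  carrier : Type u
  [meas : MeasurableSpace carrier]
  [borel : StandardBorelSpace carrier]
  P : Measure carrier
  [prob : IsProbabilityMeasure P]

namespace SBPS

instance : CoeSort SBPS.{u} (Type u) := ⟨carrier⟩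

attribute [instance] meas borel prob

/-- A morphism of standard Borel probability spaces: a measure-preserving measurable map. -/
def Map (X Y : SBPS.{u}) : Type u := {f : X → Y // MeasurePreserving f X.P Y.P}

/-- An isomorphism of standard Borel probability spaces. -/
def Iso (X Y : SBPS.{u}) : Type u := {e : X ≃ᵐ Y // MeasurePreserving e X.P Y.P}

namespace Map

/-- The identity map. -/
def id (X : SBPS.{u}) : Map X X := ⟨_root_.id, MeasurePreserving.id _⟩

/-- `g.comp f` is `g ∘ f`. -/
def comp {X Y Z : SBPS.{u}} (g : Map Y Z) (f : Map X Y) : Map X Z :=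
  ⟨g.1 ∘ f.1, g.2.comp f.2⟩

end Map

/-- The morphism underlying an isomorphism. -/
def Iso.toMap {X Y : SBPS.{u}} (e : Iso X Y) : Map X Y := ⟨e.1, e.2⟩

/-- The morphism underlying the inverse of an isomorphism. -/
def Iso.invMap {X Y : SBPS.{u}} (e : Iso X Y) : Map Y X := ⟨e.1.symm, e.2.symm⟩

/-- Almost-sure equality of measure-preserving maps. -/
instance asSetoid (X Y : SBPS.{u}) : Setoid (Map X Y) where
  r f g := f.1 =ᵐ[X.P] g.1
  iseqv := ⟨fun _ => .rfl, fun h => h.symm, fun h h' => h.trans h'⟩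

/-- Measure-preserving maps modulo almost-sure equality. -/
def Hom₀ (X Y : SBPS.{u}) : Type u := Quotient (asSetoid X Y)

/-- The class of a map. -/
def Map.cls {X Y : SBPS.{u}} (f : Map X Y) : Hom₀ X Y := Quotient.mk _ f

/-- Composition of classes, `[f]`, `[g]` being sent to `[g ∘ f]`. -/
def Hom₀.comp {X Y Z : SBPS.{u}} (f : Hom₀ X Y) (g : Hom₀ Y Z) : Hom₀ X Z :=
  Quotient.map₂ (fun f g => g.comp f) (by
    intro f f' hf g g' hg
    have h1 : g.1 ∘ f.1 =ᵐ[X.P] g'.1 ∘ f.1 := f.2.quasiMeasurePreserving.ae_eq_comp hg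
    have h2 : g'.1 ∘ f.1 =ᵐ[X.P] g'.1 ∘ f'.1 := Filter.EventuallyEq.fun_comp hf g'.1
    exact h1.trans h2) f g

/-- The measure `U ↦ ∫ (D ω ⊗ E ω) U dP(ω)`. -/
noncomputable def condProdMeasure {A B C : Type*} [MeasurableSpace A] [MeasurableSpace B]
    [MeasurableSpace C] (P : Measure C) (D : Kernel C A) (E : Kernel C B) : Measure (A × B) :=
  P.bind (fun ω => (D ω).prod (E ω))

section

variable {A B C : Type*} [MeasurableSpace A] [MeasurableSpace B] [MeasurableSpace C]
  (P : Measure C) (D : Kernel C A) (E : Kernel C B) [IsMarkovKernel D] [IsMarkovKernel E]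

theorem condProdMeasure_eq : condProdMeasure P D E = P.bind (D ×ₖ E) := by
  unfold condProdMeasure
  congr 1
  ext1 ω
  rw [Kernel.prod_apply]

instance [IsProbabilityMeasure P] : IsProbabilityMeasure (condProdMeasure P D E) := by
  rw [condProdMeasure_eq]
  infer_instance

theorem condProdMeasure_map_fst {PA : Measure A} {r : A → C} (hr : MeasurePreserving r PA P)
    (hD : IsDisintegration PA r D) : (condProdMeasure P D E).map Prod.fst = PA := by
  rw [condProdMeasure_eq]
  ext S hS
  rw [Measure.map_apply measurable_fst hS,
    Measure.bind_apply (measurable_fst hS) (Kernel.aemeasurable _), hD.total S hS, hr.map_eq]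
  refine lintegral_congr fun ω => ?_
  rw [Kernel.prod_apply, ← Set.prod_univ, Measure.prod_prod, measure_univ, mul_one]

theorem condProdMeasure_map_snd {PB : Measure B} {s : B → C} (hs : MeasurePreserving s PB P)
    (hE : IsDisintegration PB s E) : (condProdMeasure P D E).map Prod.snd = PB := by
  rw [condProdMeasure_eq]
  ext S hS
  rw [Measure.map_apply measurable_snd hS,
    Measure.bind_apply (measurable_snd hS) (Kernel.aemeasurable _), hE.total S hS, hs.map_eq]
  refine lintegral_congr fun ω => ?_
  rw [Kernel.prod_apply, ← Set.univ_prod, Measure.prod_prod, measure_univ, one_mul]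

end

/-- The conditional product of `Y` and `Z` over `W`, formed from kernels `D` from `W` to `Y` and
`E` from `W` to `Z`. -/
noncomputable def condProd {Y Z W : SBPS.{u}} (D : Kernel W Y) (E : Kernel W Z)
    [IsMarkovKernel D] [IsMarkovKernel E] : SBPS.{u} where
  carrier := Y × Z
  P := condProdMeasure W.P D E

/-- The first projection from the conditional product formed from disintegrations. -/
def condProdFst {Y Z W : SBPS.{u}} (r : Map Y W) {D : Kernel W Y} (E : Kernel W Z)
    [IsMarkovKernel D] [IsMarkovKernel E] (hD : IsDisintegration Y.P r.1 D) :
    Map (condProd D E) Y :=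
  ⟨Prod.fst, measurable_fst, condProdMeasure_map_fst W.P D E r.2 hD⟩

/-- The second projection from the conditional product formed from disintegrations. -/
def condProdSnd {Y Z W : SBPS.{u}} (s : Map Z W) (D : Kernel W Y) {E : Kernel W Z}
    [IsMarkovKernel D] [IsMarkovKernel E] (hE : IsDisintegration Z.P s.1 E) :
    Map (condProd D E) Z :=
  ⟨Prod.snd, measurable_snd, condProdMeasure_map_snd W.P D E s.2 hE⟩

/-- The space `Y × Z` with the joint law of `p` and `q`. -/
noncomputable def jointLaw {X Y Z : SBPS.{u}} (p : Map X Y) (q : Map X Z) : SBPS.{u} where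
  carrier := Y × Z
  P := X.P.map (fun x => (p.1 x, q.1 x))
  prob := Measure.isProbabilityMeasure_map (p.2.measurable.prodMk q.2.measurable).aemeasurable

/-- The map `(p, q)` from `X` to the joint law of `p` and `q`. -/
def jointMap {X Y Z : SBPS.{u}} (p : Map X Y) (q : Map X Z) : Map X (jointLaw p q) :=
  ⟨fun x => (p.1 x, q.1 x), p.2.measurable.prodMk q.2.measurable, rfl⟩

/-- The first projection from the joint law. -/
def jointFst {X Y Z : SBPS.{u}} (p : Map X Y) (q : Map X Z) : Map (jointLaw p q) Y :=
  ⟨Prod.fst, measurable_fst,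
    (Measure.map_map measurable_fst (p.2.measurable.prodMk q.2.measurable)).trans p.2.map_eq⟩

/-- The second projection from the joint law. -/
def jointSnd {X Y Z : SBPS.{u}} (p : Map X Y) (q : Map X Z) : Map (jointLaw p q) Z :=
  ⟨Prod.snd, measurable_snd,
    (Measure.map_map measurable_snd (p.2.measurable.prodMk q.2.measurable)).trans q.2.map_eq⟩

end SBPS

/-! ### The category of standard Borel probability spaces modulo almost-sure equality -/

/-- A family of standard Borel probability spaces that contains every such space up to
isomorphism. -/
def ContainsEverySBPS {ι : Type w} (sp : ι → SBPS.{u}) : Prop :=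
  ∀ Ω : SBPS.{u}, ∃ i : ι, Nonempty (SBPS.Iso Ω (sp i))

/-- The objects of the category of the spaces `sp i`.  This is a small category if `ι` is small;
for `sp = id` it is the category of all standard Borel probability spaces (of a universe). -/
@[ext]
structure SBP₀ {ι : Type w} (sp : ι → SBPS.{u}) where
  of ::
  idx : ι

namespace SBP₀

variable {ι : Type w} {sp : ι → SBPS.{u}}

/-- The space named by an object. -/
abbrev space (X : SBP₀ sp) : SBPS.{u} := sp X.idx

/-- Morphisms are all measure-preserving maps between the spaces, modulo almost-sure equality. -/
instance : Category.{u} (SBP₀ sp) where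
  Hom X Y := SBPS.Hom₀ X.space Y.space
  id X := (SBPS.Map.id X.space).cls
  comp f g := SBPS.Hom₀.comp f g
  id_comp f := by
    induction f using Quotient.inductionOn
    rfl
  comp_id f := by
    induction f using Quotient.inductionOn
    rfl
  assoc f g h := by
    induction f using Quotient.inductionOn
    induction g using Quotient.inductionOn
    induction h using Quotient.inductionOn
    rfl

/-- The morphism `[f]` given by a measure-preserving map `f`. -/
def homMk {X Y : SBP₀ sp} (f : SBPS.Map X.space Y.space) : X ⟶ Y := f.cls

/-- A commuting square `[p], [q], [r], [s]`, with `r ∘ p = s ∘ q` almost surely, is independent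
if `p` and `q` are conditionally independent given `r ∘ p`. -/
def indepSquares (sp : ι → SBPS.{u}) : IndependentSquares (SBP₀ sp) where
  Indep {X Y _ W} f g u v :=
    f ≫ u = g ≫ v ∧ ∃ (p : SBPS.Map X.space Y.space) (q : SBPS.Map X.space _)
      (r : SBPS.Map Y.space W.space),
      homMk p = f ∧ homMk q = g ∧ homMk r = u ∧ CondIndepRV X.space.P p.1 q.1 (r.1 ∘ p.1)
  comm h := h.1

end SBP₀

/-! Independence of a commuting square is a property of the joint law of its legs: it holds iff this
law is the conditional product of the cospan, a measure on `Y × Z` that the legs do not enter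
(`condIndepRV_iff_map_eq`, `indep_iff_condProdMeasure`). Representatives therefore do not matter,
transposition is a swap of coordinates, and descent holds because precomposing with a
measure-preserving map keeps the joint law. Pairs of maps with joint law `μ` are the same as maps
into `(Y × Z, μ)` (`existsUnique_lift`), which gives the universal properties of independent
pullbacks and of pairings.

Pasting uses an asymmetric form: given `p = y`, the law of `q` is `E (r y)`, with `E` a
disintegration of `s` (`indep_iff_compProd`). Such conditional laws compose. For the converse, axiom
4, an independent pullback (B) allows the points of `X₁` to be recovered almost surely from their
images in `Y₁` and `X₂` (`exists_leftInverse`). The joint law over (A) is thus a function of the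
joint law over (AB), and it can be compared with that of an independent pullback over the same
cospan. -/

section Laws

variable {Ω A B C : Type*} [MeasurableSpace Ω] [MeasurableSpace A] [MeasurableSpace B]
  [MeasurableSpace C]

/-! ### Calculus of disintegrations: fibres, uniqueness, images. -/

namespace IsDisintegration

/-- Under a disintegration, almost-sure events are almost surely conditionally almost sure. -/
theorem ae_ae {P : Measure Ω} {X : Ω → A} {D : Kernel A Ω} (hD : IsDisintegration P X D)
    {S : Set Ω} (hS : MeasurableSet S) (h : ∀ᵐ ω ∂P, ω ∈ S) :
    ∀ᵐ x ∂(P.map X), ∀ᵐ ω ∂(D x), ω ∈ S := by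
  have h0 : P Sᶜ = 0 := h
  rw [hD.total _ hS.compl, lintegral_eq_zero_iff (D.measurable_coe hS.compl)] at h0
  filter_upwards [h0] with x hx
  exact hx

theorem ae_fibre [MeasurableSingletonClass A] {P : Measure Ω} {X : Ω → A} {D : Kernel A Ω}
    (hX : Measurable X) (hD : IsDisintegration P X D) :
    ∀ᵐ x ∂(P.map X), ∀ᵐ ω ∂(D x), X ω = x := by
  have := hD.markov
  filter_upwards [hD.fibre] with x hx
  exact (prob_compl_eq_zero_iff (hX (measurableSet_singleton x))).2 hx

/-- A kernel satisfying the total probability formula and concentrated on the fibres is a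
disintegration. -/
theorem of_ae_fibre [MeasurableSingletonClass A] {P : Measure Ω} {X : Ω → A} {D : Kernel A Ω}
    [IsMarkovKernel D] (hX : Measurable X) (h : ∀ᵐ x ∂(P.map X), ∀ᵐ ω ∂(D x), X ω = x)
    (htot : ∀ S : Set Ω, MeasurableSet S → P S = ∫⁻ x, D x S ∂(P.map X)) :
    IsDisintegration P X D where
  markov := inferInstance
  fibre := by
    filter_upwards [h] with x hx
    exact (prob_compl_eq_zero_iff (hX (measurableSet_singleton x))).1 hx
  total := htot

/-- As `D x` lives on the fibre over `x`, its value on `X ⁻¹' T ∩ S` is `D x S` for `x ∈ T` and `0`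
otherwise. These integrals determine `D` almost surely. -/
theorem setLIntegral [MeasurableSingletonClass A] {P : Measure Ω} {X : Ω → A} {D : Kernel A Ω}
    (hX : Measurable X) (hD : IsDisintegration P X D) {T : Set A} (hT : MeasurableSet T)
    {S : Set Ω} (hS : MeasurableSet S) :
    ∫⁻ x in T, D x S ∂(P.map X) = P (X ⁻¹' T ∩ S) := by
  rw [hD.total _ ((hX hT).inter hS), ← lintegral_indicator hT]
  refine lintegral_congr_ae ?_
  filter_upwards [hD.ae_fibre hX] with x hx
  by_cases hxT : x ∈ T
  · rw [Set.indicator_of_mem hxT]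
    refine measure_congr ?_
    filter_upwards [hx] with ω hω
    refine propext ⟨fun h => ⟨?_, h⟩, fun h => h.2⟩
    rwa [Set.mem_preimage, hω]
  · rw [Set.indicator_of_notMem hxT]
    refine (measure_eq_zero_iff_ae_notMem.2 ?_).symm
    filter_upwards [hx] with ω hω h
    exact hxT (hω ▸ h.1)

theorem compProd_eq [MeasurableSingletonClass A] {P : Measure Ω} [IsFiniteMeasure P] {X : Ω → A}
    {D : Kernel A Ω} (hX : Measurable X) (hD : IsDisintegration P X D) :
    (P.map X) ⊗ₘ D = P.map (fun ω => (X ω, ω)) := by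
  have := hD.markov
  refine Measure.ext_prod fun {T S} hT hS => ?_
  rw [Measure.compProd_apply_prod hT hS, hD.setLIntegral hX hT hS,
    Measure.map_apply (by fun_prop) (hT.prod hS)]
  rfl

/-- Disintegrations are almost surely unique. -/
theorem ae_eq [MeasurableSingletonClass A] {P : Measure Ω} [IsFiniteMeasure P]
    {X : Ω → A} {D E : Kernel A Ω} (hX : Measurable X) (hD : IsDisintegration P X D)
    (hE : IsDisintegration P X E) {S : Set Ω} (hS : MeasurableSet S) :
    (fun x => D x S) =ᵐ[P.map X] fun x => E x S := by
  refine ae_eq_of_forall_setLIntegral_eq_of_sigmaFinite (D.measurable_coe hS)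
    (E.measurable_coe hS) fun T hT _ => ?_
  rw [hD.setLIntegral hX hT hS, hE.setLIntegral hX hT hS]

/-- The image of a disintegration of `Z` along `p` is a disintegration of `r` if `Z = r ∘ p`
almost surely. -/
theorem map [StandardBorelSpace C] {P : Measure Ω} {Q : Measure A} {Z : Ω → C} {p : Ω → A}
    {r : A → C} {F : Kernel C Ω} (hZ : Measurable Z) (hF : IsDisintegration P Z F)
    (hp : MeasurePreserving p P Q) (hr : Measurable r) (h : Z =ᵐ[P] r ∘ p) :
    IsDisintegration Q r (F.map p) := by
  have := hF.markov
  have : IsMarkovKernel (F.map p) := Kernel.IsMarkovKernel.map F hp.measurable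
  have hQ : Q.map r = P.map Z := by
    rw [← hp.map_eq, Measure.map_map hr hp.measurable, Measure.map_congr h]
  refine of_ae_fibre hr ?_ fun S hS => ?_
  · rw [hQ]
    have hm : MeasurableSet {ω | Z ω = (r ∘ p) ω} :=
      measurableSet_eq_fun hZ (hr.comp hp.measurable)
    filter_upwards [hF.ae_fibre hZ, hF.ae_ae hm h] with z h1 h2
    rw [Kernel.map_apply _ hp.measurable]
    refine (ae_map_iff hp.measurable.aemeasurable
      (hr (measurableSet_singleton z))).2 ?_
    filter_upwards [h1, h2] with ω h1 h2
    exact h2.symm.trans h1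
  · rw [hQ, ← hp.measure_preimage hS.nullMeasurableSet, hF.total _ (hp.measurable hS)]
    refine lintegral_congr fun z => ?_
    rw [Kernel.map_apply' _ hp.measurable _ hS]

theorem congr_ae [StandardBorelSpace C] {P : Measure Ω} {Z Z' : Ω → C} {F : Kernel C Ω}
    (hZ : Measurable Z) (hZ' : Measurable Z') (h : Z =ᵐ[P] Z') (hF : IsDisintegration P Z F) :
    IsDisintegration P Z' F := by
  simpa [Kernel.map_id] using hF.map hZ (MeasurePreserving.id P) hZ' h

end IsDisintegration

/-! ### Conditional products and conditional independence as a condition on joint laws. -/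

namespace SBPS

theorem condProdMeasure_prod (P : Measure C) (D : Kernel C A) (E : Kernel C B)
    [IsMarkovKernel D] [IsMarkovKernel E] {S : Set A} {T : Set B} (hS : MeasurableSet S)
    (hT : MeasurableSet T) :
    condProdMeasure P D E (S ×ˢ T) = ∫⁻ ω, D ω S * E ω T ∂P := by
  rw [condProdMeasure_eq, Measure.bind_apply (hS.prod hT) (Kernel.aemeasurable _)]
  refine lintegral_congr fun ω => ?_
  rw [Kernel.prod_apply, Measure.prod_prod]

theorem condProdMeasure_swap (P : Measure C) (D : Kernel C A) (E : Kernel C B)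
    [IsMarkovKernel D] [IsMarkovKernel E] [IsProbabilityMeasure P] :
    (condProdMeasure P D E).map Prod.swap = condProdMeasure P E D := by
  have : IsProbabilityMeasure ((condProdMeasure P D E).map Prod.swap) :=
    Measure.isProbabilityMeasure_map measurable_swap.aemeasurable
  refine Measure.ext_prod fun {S T} hS hT => ?_
  rw [Measure.map_apply measurable_swap (hS.prod hT), Set.preimage_swap_prod,
    condProdMeasure_prod _ _ _ hT hS, condProdMeasure_prod _ _ _ hS hT]
  simp_rw [mul_comm]

/-- Both sides integrate `1_S(y) g(ω)` against the law of `(r y, y)`, once through the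
disintegration and once directly. -/
theorem lintegral_mul_disintegration [StandardBorelSpace C] {P : Measure C} {Q : Measure A}
    [IsFiniteMeasure Q] {r : A → C} {D : Kernel C A} (hr : MeasurePreserving r Q P)
    (hD : IsDisintegration Q r D) {S : Set A} (hS : MeasurableSet S) {g : C → ENNReal}
    (hg : Measurable g) : ∫⁻ ω, D ω S * g ω ∂P = ∫⁻ y in S, g (r y) ∂Q := by
  have := hD.markov
  have hrm := hr.measurable
  have h := hD.compProd_eq hrm
  have hm : Measurable fun z : C × A => S.indicator (fun _ => g z.1) z.2 := by
    have : (fun z : C × A => S.indicator (fun _ => g z.1) z.2)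
        = (Prod.snd ⁻¹' S).indicator (fun z => g z.1) := by
      ext z; rfl
    rw [this]
    exact (hg.comp measurable_fst).indicator (measurable_snd hS)
  have h2 := congrArg (fun μ => ∫⁻ z, S.indicator (fun _ => g z.1) z.2 ∂μ) h
  beta_reduce at h2
  rw [Measure.lintegral_compProd hm,
    lintegral_map hm (by fun_prop), hr.map_eq] at h2
  rw [← lintegral_indicator hS]
  refine Eq.trans (lintegral_congr fun ω => ?_) (h2.trans (lintegral_congr fun y => ?_))
  · exact (mul_comm _ _).trans (lintegral_indicator_const hS (g ω)).symm
  · simp only [Set.indicator]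

/-- The conditional product in terms of one of the disintegrations. -/
theorem condProdMeasure_eq_compProd [StandardBorelSpace C] {P : Measure C} {Q : Measure A}
    [IsProbabilityMeasure Q] [IsProbabilityMeasure P] {r : A → C} {D : Kernel C A}
    (E : Kernel C B) [IsMarkovKernel D] [IsMarkovKernel E] (hr : MeasurePreserving r Q P)
    (hD : IsDisintegration Q r D) :
    condProdMeasure P D E = Q ⊗ₘ (E.comap r hr.measurable) := by
  refine Measure.ext_prod fun {S T} hS hT => ?_
  rw [condProdMeasure_prod _ _ _ hS hT, Measure.compProd_apply_prod hS hT,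
    lintegral_mul_disintegration hr hD hS (E.measurable_coe hT)]
  simp [Kernel.comap_apply]

/-- Two maps over a common space are conditionally independent iff their joint law is the
conditional product. -/
theorem condIndepRV_iff_map_eq [StandardBorelSpace Ω] [StandardBorelSpace C]
    {P : Measure Ω} [IsProbabilityMeasure P] {PA : Measure A} {PB : Measure B} {PC : Measure C}
    {p : Ω → A} {q : Ω → B} {r : A → C} {s : B → C} {D : Kernel C A} {E : Kernel C B}
    [IsMarkovKernel D] [IsMarkovKernel E]
    (hp : MeasurePreserving p P PA) (hq : MeasurePreserving q P PB)
    (hr : MeasurePreserving r PA PC) (hs : MeasurePreserving s PB PC)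
    (hD : IsDisintegration PA r D) (hE : IsDisintegration PB s E) (h : r ∘ p =ᵐ[P] s ∘ q) :
    CondIndepRV P p q (r ∘ p) ↔ P.map (fun ω => (p ω, q ω)) = condProdMeasure PC D E := by
  have hZ := hr.comp hp
  have hpq := hp.measurable.prodMk hq.measurable
  have hPA : IsProbabilityMeasure PA := hp.map_eq ▸
    Measure.isProbabilityMeasure_map hp.measurable.aemeasurable
  have hPB : IsProbabilityMeasure PB := hq.map_eq ▸
    Measure.isProbabilityMeasure_map hq.measurable.aemeasurable
  have hPC : IsProbabilityMeasure PC := hZ.map_eq ▸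
    Measure.isProbabilityMeasure_map hZ.measurable.aemeasurable
  have hmap : IsProbabilityMeasure (P.map (fun ω => (p ω, q ω))) :=
    Measure.isProbabilityMeasure_map hpq.aemeasurable
  -- The images of `F` under `p` and `q` disintegrate `r` and `s`, so uniqueness identifies them
  -- with `D` and `E`.
  have key : ∀ F : Kernel C Ω, IsDisintegration P (r ∘ p) F → ∀ (S : Set A) (T : Set B),
      MeasurableSet S → MeasurableSet T →
      (fun z => F z (p ⁻¹' S) * F z (q ⁻¹' T)) =ᵐ[PC] fun z => D z S * E z T := by
    intro F hF S T hS hT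
    have h1 := (hF.map hZ.measurable hp hr.measurable .rfl).ae_eq hr.measurable hD hS
    have h2 := (hF.map hZ.measurable hq hs.measurable h).ae_eq hs.measurable hE hT
    rw [hr.map_eq] at h1
    rw [hs.map_eq] at h2
    filter_upwards [h1, h2] with z h1 h2
    rw [← h1, ← h2, Kernel.map_apply' _ hp.measurable _ hS, Kernel.map_apply' _ hq.measurable _ hT]
  constructor
  · rintro ⟨F, hF, hi⟩
    refine Measure.ext_prod fun {S T} hS hT => ?_
    rw [Measure.map_apply hpq (hS.prod hT), condProdMeasure_prod _ _ _ hS hT,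
      ← lintegral_congr_ae (key F hF S T hS hT)]
    have hi := hi S T hS hT
    rw [← hZ.map_eq, ← lintegral_congr_ae hi,
      ← hF.total _ ((hp.measurable hS).inter (hq.measurable hT))]
    rfl
  · intro hlaw
    obtain ⟨F, hF⟩ := exists_isDisintegration P hZ.measurable
    refine ⟨F, hF, fun S T hS hT => ?_⟩
    have hST := (hp.measurable hS).inter (hq.measurable hT)
    have hk := key F hF S T hS hT
    rw [hZ.map_eq]
    refine Filter.EventuallyEq.trans ?_ hk.symm
    refine ae_eq_of_forall_setLIntegral_eq_of_sigmaFinite (F.measurable_coe hST)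
      ((D.measurable_coe hS).mul (E.measurable_coe hT)) fun U hU _ => ?_
    have e1 := hF.setLIntegral hZ.measurable hU hST
    rw [hZ.map_eq] at e1
    -- The condition `r (p ω) ∈ U` concerns `p` alone, so it can be absorbed into the first side of
    -- a rectangle, where the joint law is known.
    have e2 : P ((r ∘ p) ⁻¹' U ∩ (p ⁻¹' S ∩ q ⁻¹' T)) =
        P.map (fun ω => (p ω, q ω)) ((r ⁻¹' U ∩ S) ×ˢ T) := by
      rw [Measure.map_apply hpq (((hr.measurable hU).inter hS).prod hT)]
      congr 1
      ext ω
      simp [and_assoc]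
    rw [e1, e2, hlaw, condProdMeasure_eq_compProd E hr hD,
      Measure.compProd_apply_prod ((hr.measurable hU).inter hS) hT]
    have e3 := lintegral_mul_disintegration hr hD hS
      (((E.measurable_coe hT)).indicator hU)
    rw [← lintegral_indicator hU]
    refine Eq.trans ?_ (e3.symm.trans (lintegral_congr fun z => ?_))
    · rw [← Measure.restrict_restrict (hr.measurable hU),
        ← lintegral_indicator (hr.measurable hU)]
      rfl
    · by_cases hz : z ∈ U <;> simp [hz]

end SBPS

end Laws

/-- The inverse of an isomorphism. -/
def SBPS.Iso.symm {X Y : SBPS.{u}} (e : SBPS.Iso X Y) : SBPS.Iso Y X := ⟨e.1.symm, e.2.symm⟩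

namespace SBP₀

variable {ι : Type w} {sp : ι → SBPS.{u}}

theorem exists_homMk {X Y : SBP₀ sp} (f : X ⟶ Y) :
    ∃ p : SBPS.Map X.space Y.space, homMk p = f :=
  Quotient.exists_rep f

theorem homMk_eq_iff {X Y : SBP₀ sp} {p q : SBPS.Map X.space Y.space} :
    (homMk p : X ⟶ Y) = homMk q ↔ p.1 =ᵐ[X.space.P] q.1 :=
  Quotient.eq

theorem homMk_comp {X Y Z : SBP₀ sp} (p : SBPS.Map X.space Y.space)
    (q : SBPS.Map Y.space Z.space) :
    (homMk p : X ⟶ Y) ≫ (homMk q : Y ⟶ Z) = homMk (q.comp p) :=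
  rfl

/-! ### Criteria for independence of a square. -/

section Laws

variable {X Y Z W : SBP₀ sp} (p : SBPS.Map X.space Y.space) (q : SBPS.Map X.space Z.space)
  (r : SBPS.Map Y.space W.space) (s : SBPS.Map Z.space W.space)

/-- A square is independent iff the joint law of its legs is the conditional product. -/
theorem indep_iff_condProdMeasure {D : Kernel W.space Y.space} {E : Kernel W.space Z.space}
    [IsMarkovKernel D] [IsMarkovKernel E]
    (hD : IsDisintegration Y.space.P r.1 D) (hE : IsDisintegration Z.space.P s.1 E) :
    (indepSquares sp).Indep (homMk p) (homMk q) (homMk r) (homMk s) ↔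
      r.1 ∘ p.1 =ᵐ[X.space.P] s.1 ∘ q.1 ∧
        X.space.P.map (fun x => (p.1 x, q.1 x)) = SBPS.condProdMeasure W.space.P D E := by
  constructor
  · rintro ⟨hc, p', q', r', hp, hq, hr, hi⟩
    refine ⟨homMk_eq_iff.1 hc, ?_⟩
    rw [← hp, ← hq, ← hr, homMk_comp, homMk_comp, homMk_eq_iff] at hc
    have hp := homMk_eq_iff.1 hp
    have hq := homMk_eq_iff.1 hq
    have hr := homMk_eq_iff.1 hr
    -- `D` also disintegrates the representative `r'` chosen in the definition, so the same
    -- conditional product serves for both triples.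
    have hD' := hD.congr_ae r.2.measurable r'.2.measurable hr.symm
    rw [← (SBPS.condIndepRV_iff_map_eq p'.2 q'.2 r'.2 s.2 hD' hE hc).1 hi]
    refine Measure.map_congr ?_
    filter_upwards [hp, hq] with x h1 h2
    rw [h1, h2]
  · rintro ⟨hc, hl⟩
    exact ⟨homMk_eq_iff.2 hc, p, q, r, rfl, rfl, rfl,
      (SBPS.condIndepRV_iff_map_eq p.2 q.2 r.2 s.2 hD hE hc).2 hl⟩

/-- Given commutation, both sides say that the joint law is the conditional product. -/
theorem indep_homMk_iff :
    (indepSquares sp).Indep (homMk p) (homMk q) (homMk r) (homMk s) ↔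
      r.1 ∘ p.1 =ᵐ[X.space.P] s.1 ∘ q.1 ∧ CondIndepRV X.space.P p.1 q.1 (r.1 ∘ p.1) := by
  obtain ⟨D, hD⟩ := exists_isDisintegration Y.space.P r.2.measurable
  obtain ⟨E, hE⟩ := exists_isDisintegration Z.space.P s.2.measurable
  have := hD.markov
  have := hE.markov
  rw [indep_iff_condProdMeasure p q r s hD hE]
  exact and_congr_right fun hc =>
    (SBPS.condIndepRV_iff_map_eq p.2 q.2 r.2 s.2 hD hE hc).symm

/-- A square is independent iff the conditional law of `q` given `p` is pulled back along `r` from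
the disintegration of `s`. -/
theorem indep_iff_compProd {E : Kernel W.space Z.space} [IsMarkovKernel E]
    (hE : IsDisintegration Z.space.P s.1 E) :
    (indepSquares sp).Indep (homMk p) (homMk q) (homMk r) (homMk s) ↔
      r.1 ∘ p.1 =ᵐ[X.space.P] s.1 ∘ q.1 ∧
        X.space.P.map (fun x => (p.1 x, q.1 x)) = Y.space.P ⊗ₘ (E.comap r.1 r.2.measurable) := by
  obtain ⟨D, hD⟩ := exists_isDisintegration Y.space.P r.2.measurable
  have := hD.markov
  rw [indep_iff_condProdMeasure p q r s hD hE, SBPS.condProdMeasure_eq_compProd E r.2 hD]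

theorem map_prodMk_apply {S : Set Y.space} {T : Set Z.space} (hS : MeasurableSet S)
    (hT : MeasurableSet T) :
    X.space.P.map (fun x => (p.1 x, q.1 x)) (S ×ˢ T) = X.space.P (p.1 ⁻¹' S ∩ q.1 ⁻¹' T) :=
  Measure.map_apply (p.2.measurable.prodMk q.2.measurable) (hS.prod hT)

/-- This invariance is the whole content of descent, and it also fixes the law of every pair
factorisation of a span. -/
theorem map_prodMk_comp {T : SBP₀ sp} (k : SBPS.Map T.space X.space) :
    T.space.P.map (fun x => ((p.comp k).1 x, (q.comp k).1 x)) =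
      X.space.P.map (fun x => (p.1 x, q.1 x)) :=
  ((Measure.map_map (p.2.measurable.prodMk q.2.measurable) k.2.measurable).symm).trans
    (congrArg _ k.2.map_eq)

theorem indep_iff_setLIntegral {E : Kernel W.space Z.space} [IsMarkovKernel E]
    (hE : IsDisintegration Z.space.P s.1 E) :
    (indepSquares sp).Indep (homMk p) (homMk q) (homMk r) (homMk s) ↔
      r.1 ∘ p.1 =ᵐ[X.space.P] s.1 ∘ q.1 ∧
        ∀ (S : Set Y.space) (T : Set Z.space), MeasurableSet S → MeasurableSet T →
          X.space.P (p.1 ⁻¹' S ∩ q.1 ⁻¹' T) = ∫⁻ y in S, E (r.1 y) T ∂Y.space.P := by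
  have : IsProbabilityMeasure (X.space.P.map (fun x => (p.1 x, q.1 x))) :=
    (SBPS.jointLaw p q).prob
  rw [indep_iff_compProd p q r s hE]
  refine and_congr_right fun _ => ⟨fun h S T hS hT => ?_, fun h => ?_⟩
  · rw [← map_prodMk_apply p q hS hT, h, Measure.compProd_apply_prod hS hT]
    rfl
  · refine Measure.ext_prod fun {S T} hS hT => ?_
    rw [map_prodMk_apply p q hS hT, h S T hS hT, Measure.compProd_apply_prod hS hT]
    rfl

/-- The conditional product square commutes almost surely. -/
theorem ae_condProdMeasure {D : Kernel W.space Y.space} {E : Kernel W.space Z.space}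
    [IsMarkovKernel D] [IsMarkovKernel E]
    (hD : IsDisintegration Y.space.P r.1 D) (hE : IsDisintegration Z.space.P s.1 E) :
    ∀ᵐ x ∂(SBPS.condProdMeasure W.space.P D E), r.1 x.1 = s.1 x.2 := by
  rw [SBPS.condProdMeasure_eq_compProd E r.2 hD]
  refine Measure.ae_compProd_of_ae_ae (measurableSet_eq_fun
    (r.2.measurable.comp measurable_fst) (s.2.measurable.comp measurable_snd)) ?_
  have h := hE.ae_fibre s.2.measurable
  rw [s.2.map_eq] at h
  filter_upwards [r.2.quasiMeasurePreserving.ae h] with y hy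
  rw [Kernel.comap_apply]
  filter_upwards [hy] with z hz
  exact hz.symm

end Laws

/-! ### Universal properties of conditional products and joint laws. -/

/-- A pair of maps with joint law `μ` factors uniquely through any object representing the
product with the measure `μ`. -/
theorem existsUnique_lift {X X' Y Z : SBP₀ sp} {μ : Measure (Y.space × Z.space)}
    (e : X'.space ≃ᵐ Y.space × Z.space) (he : MeasurePreserving e X'.space.P μ)
    (h₁ : MeasurePreserving (Prod.fst ∘ e) X'.space.P Y.space.P)
    (h₂ : MeasurePreserving (Prod.snd ∘ e) X'.space.P Z.space.P)
    (p : SBPS.Map X.space Y.space) (q : SBPS.Map X.space Z.space)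
    (hpq : X.space.P.map (fun x => (p.1 x, q.1 x)) = μ) :
    ∃! h : X ⟶ X', h ≫ (homMk ⟨_, h₁⟩ : X' ⟶ Y) = homMk p ∧
      h ≫ (homMk ⟨_, h₂⟩ : X' ⟶ Z) = homMk q := by
  have hm : MeasurePreserving (fun x => (p.1 x, q.1 x)) X.space.P μ :=
    ⟨p.2.measurable.prodMk q.2.measurable, hpq⟩
  refine ⟨homMk ⟨e.symm ∘ fun x => (p.1 x, q.1 x), (he.symm e).comp hm⟩, ⟨?_, ?_⟩, ?_⟩
  · refine homMk_eq_iff.2 (.of_forall fun x => ?_)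
    simp [SBPS.Map.comp]
  · refine homMk_eq_iff.2 (.of_forall fun x => ?_)
    simp [SBPS.Map.comp]
  · rintro h ⟨hf, hg⟩
    obtain ⟨k, rfl⟩ := exists_homMk h
    refine homMk_eq_iff.2 ?_
    filter_upwards [homMk_eq_iff.1 hf, homMk_eq_iff.1 hg] with x h1 h2
    exact (e.symm_apply_eq.2 (Prod.ext h1 h2).symm).symm

theorem condProd_isIndependentPullback {Y Z W : SBP₀ sp} (r : SBPS.Map Y.space W.space)
    (s : SBPS.Map Z.space W.space) (D : Kernel W.space Y.space) (E : Kernel W.space Z.space)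
    [IsMarkovKernel D] [IsMarkovKernel E]
    (hD : IsDisintegration Y.space.P r.1 D) (hE : IsDisintegration Z.space.P s.1 E)
    (X : SBP₀ sp) (e : SBPS.Iso X.space (SBPS.condProd D E)) :
    (indepSquares sp).IsIndependentPullback
      (homMk ((SBPS.condProdFst r E hD).comp e.toMap) : X ⟶ Y)
      (homMk ((SBPS.condProdSnd s D hE).comp e.toMap) : X ⟶ Z) (homMk r) (homMk s) := by
  refine ⟨(indep_iff_condProdMeasure _ _ r s hD hE).2
    ⟨e.2.quasiMeasurePreserving.ae (ae_condProdMeasure r s hD hE), e.2.map_eq⟩, ?_⟩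
  intro X' f g h
  obtain ⟨p, rfl⟩ := exists_homMk f
  obtain ⟨q, rfl⟩ := exists_homMk g
  exact existsUnique_lift e.1 e.2 _ _ p q ((indep_iff_condProdMeasure p q r s hD hE).1 h).2

theorem exists_isIndependentPullback (hsp : ContainsEverySBPS sp) {Y Z W : SBP₀ sp} (u : Y ⟶ W)
    (v : Z ⟶ W) :
    ∃ (X : SBP₀ sp) (f : X ⟶ Y) (g : X ⟶ Z),
      (indepSquares sp).IsIndependentPullback f g u v := by
  obtain ⟨r, rfl⟩ := exists_homMk u
  obtain ⟨s, rfl⟩ := exists_homMk v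
  obtain ⟨D, hD⟩ := exists_isDisintegration Y.space.P r.2.measurable
  obtain ⟨E, hE⟩ := exists_isDisintegration Z.space.P s.2.measurable
  have := hD.markov
  have := hE.markov
  obtain ⟨i, ⟨e⟩⟩ := hsp (SBPS.condProd D E)
  exact ⟨⟨i⟩, _, _, condProd_isIndependentPullback r s D E hD hE ⟨i⟩ e.symm⟩

/-- The map into the vertex of a pair factorisation is measure-preserving, so the legs out of that
vertex have the joint law of `(p, q)` and lift uniquely. -/
theorem jointLaw_isPairing {X Y Z : SBP₀ sp} (p : SBPS.Map X.space Y.space)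
    (q : SBPS.Map X.space Z.space) (X' : SBP₀ sp)
    (e : SBPS.Iso X'.space (SBPS.jointLaw p q)) :
    ∃ (h₁ : (homMk (e.invMap.comp (SBPS.jointMap p q)) : X ⟶ X') ≫
          (homMk ((SBPS.jointFst p q).comp e.toMap) : X' ⟶ Y) = homMk p)
      (h₂ : (homMk (e.invMap.comp (SBPS.jointMap p q)) : X ⟶ X') ≫
          (homMk ((SBPS.jointSnd p q).comp e.toMap) : X' ⟶ Z) = homMk q),
      PairFactorisation.IsPairing ⟨X', _, _, _, h₁, h₂⟩ := by
  have hsymm (z : SBPS.jointLaw p q) : e.1 (e.1.symm z) = z := e.1.apply_symm_apply z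
  have h₁ : (homMk (e.invMap.comp (SBPS.jointMap p q)) : X ⟶ X') ≫
      (homMk ((SBPS.jointFst p q).comp e.toMap) : X' ⟶ Y) = homMk p :=
    homMk_eq_iff.2 (.of_forall fun x => congrArg Prod.fst (hsymm (p.1 x, q.1 x)))
  have h₂ : (homMk (e.invMap.comp (SBPS.jointMap p q)) : X ⟶ X') ≫
      (homMk ((SBPS.jointSnd p q).comp e.toMap) : X' ⟶ Z) = homMk q :=
    homMk_eq_iff.2 (.of_forall fun x => congrArg Prod.snd (hsymm (p.1 x, q.1 x)))
  refine ⟨h₁, h₂, ?_⟩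
  rintro ⟨T, m, f, g, hf, hg⟩
  obtain ⟨m, rfl⟩ := exists_homMk m
  obtain ⟨a, rfl⟩ := exists_homMk f
  obtain ⟨b, rfl⟩ := exists_homMk g
  have hlaw : T.space.P.map (fun x => (a.1 x, b.1 x)) =
      X.space.P.map (fun x => (p.1 x, q.1 x)) := by
    rw [← map_prodMk_comp a b m]
    refine Measure.map_congr ?_
    filter_upwards [homMk_eq_iff.1 hf, homMk_eq_iff.1 hg] with x h1 h2
    exact Prod.ext h1 h2
  obtain ⟨h, ⟨hh₁, hh₂⟩, huniq⟩ := existsUnique_lift (X' := X') e.1 e.2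
    ((SBPS.jointFst p q).comp e.toMap).2 ((SBPS.jointSnd p q).comp e.toMap).2 a b hlaw
  refine ⟨h, ⟨?_, hh₁, hh₂⟩, fun k hk => huniq k hk.2⟩
  -- Compatibility with the maps out of `X` is automatic: both candidates lift the pair `(p, q)`.
  refine (existsUnique_lift (X' := X') e.1 e.2 ((SBPS.jointFst p q).comp e.toMap).2
    ((SBPS.jointSnd p q).comp e.toMap).2 p q rfl).unique ⟨?_, ?_⟩ ⟨h₁, h₂⟩
  · exact (Category.assoc _ _ _).trans ((congrArg _ hh₁).trans hf)
  · exact (Category.assoc _ _ _).trans ((congrArg _ hh₂).trans hg)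

theorem hasPairings (hsp : ContainsEverySBPS sp) : HasPairings (SBP₀ sp) := by
  intro X Y Z f g
  obtain ⟨p, rfl⟩ := exists_homMk f
  obtain ⟨q, rfl⟩ := exists_homMk g
  obtain ⟨i, ⟨e⟩⟩ := hsp (SBPS.jointLaw p q)
  obtain ⟨h₁, h₂, h⟩ := jointLaw_isPairing p q ⟨i⟩ e.symm
  exact ⟨_, h⟩

/-! ### Descent and the axioms of an independent-pullback structure. -/

theorem indepSquares_hasDescent : (indepSquares sp).HasDescent := by
  intro X' X Y Z W k f g u v hc h
  obtain ⟨k, rfl⟩ := exists_homMk k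
  obtain ⟨p, rfl⟩ := exists_homMk f
  obtain ⟨q, rfl⟩ := exists_homMk g
  obtain ⟨r, rfl⟩ := exists_homMk u
  obtain ⟨s, rfl⟩ := exists_homMk v
  obtain ⟨E, hE⟩ := exists_isDisintegration Z.space.P s.2.measurable
  have := hE.markov
  rw [homMk_comp, homMk_comp, indep_iff_compProd _ _ _ _ hE] at h
  refine (indep_iff_compProd _ _ _ _ hE).2 ⟨homMk_eq_iff.1 hc, ?_⟩
  rw [← h.2, map_prodMk_comp]

/-- With the identity at the bottom, the set-integral criterion is the defining property of a
disintegration of `g`, transported along `f`. -/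
theorem indep_of_id {X Y Z : SBP₀ sp} (f : X ⟶ Y) (g : Y ⟶ Z) :
    (indepSquares sp).Indep (f ≫ g) f (𝟙 Z) g := by
  obtain ⟨p, rfl⟩ := exists_homMk f
  obtain ⟨s, rfl⟩ := exists_homMk g
  obtain ⟨E, hE⟩ := exists_isDisintegration Y.space.P s.2.measurable
  have := hE.markov
  refine (indep_iff_setLIntegral (s.comp p) p (SBPS.Map.id Z.space) s hE).2
    ⟨.rfl, fun S T hS hT => ?_⟩
  have h := hE.setLIntegral s.2.measurable hS hT
  rw [s.2.map_eq, ← p.2.measure_preimage ((s.2.measurable hS).inter hT).nullMeasurableSet] at h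
  exact h.symm

theorem indep_symm {X Y Z W : SBP₀ sp} {f : X ⟶ Y} {g : X ⟶ Z} {u : Y ⟶ W} {v : Z ⟶ W}
    (h : (indepSquares sp).Indep f g u v) : (indepSquares sp).Indep g f v u := by
  obtain ⟨p, rfl⟩ := exists_homMk f
  obtain ⟨q, rfl⟩ := exists_homMk g
  obtain ⟨r, rfl⟩ := exists_homMk u
  obtain ⟨s, rfl⟩ := exists_homMk v
  obtain ⟨D, hD⟩ := exists_isDisintegration Y.space.P r.2.measurable
  obtain ⟨E, hE⟩ := exists_isDisintegration Z.space.P s.2.measurable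
  have := hD.markov
  have := hE.markov
  obtain ⟨h1, h2⟩ := (indep_iff_condProdMeasure p q r s hD hE).1 h
  refine (indep_iff_condProdMeasure q p s r hE hD).2 ⟨h1.symm, ?_⟩
  rw [← SBPS.condProdMeasure_swap, ← h2,
    Measure.map_map measurable_swap (p.2.measurable.prodMk q.2.measurable)]
  rfl

/-- Given `l = y`, the law of `a` is `D (b y)`. By (B), the image of `D` under `c` is almost surely
`E ∘ d`, so given `l = y` the law of `c ∘ a` is `E (d (b y))`. -/
theorem indep_paste {X X₁ X₂ Y Y₁ Y₂ : SBP₀ sp} {a : X ⟶ X₁} {c : X₁ ⟶ X₂} {l : X ⟶ Y}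
    {m : X₁ ⟶ Y₁} {n : X₂ ⟶ Y₂} {b : Y ⟶ Y₁} {d : Y₁ ⟶ Y₂}
    (hA : (indepSquares sp).Indep l a b m) (hB : (indepSquares sp).Indep m c d n) :
    (indepSquares sp).Indep l (a ≫ c) (b ≫ d) n := by
  have hc : l ≫ b ≫ d = (a ≫ c) ≫ n := by
    rw [← Category.assoc, (indepSquares sp).comm hA, Category.assoc, (indepSquares sp).comm hB,
      Category.assoc]
  obtain ⟨a, rfl⟩ := exists_homMk a
  obtain ⟨b, rfl⟩ := exists_homMk b
  obtain ⟨c, rfl⟩ := exists_homMk c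
  obtain ⟨d, rfl⟩ := exists_homMk d
  obtain ⟨l, rfl⟩ := exists_homMk l
  obtain ⟨m, rfl⟩ := exists_homMk m
  obtain ⟨n, rfl⟩ := exists_homMk n
  obtain ⟨D, hD⟩ := exists_isDisintegration X₁.space.P m.2.measurable
  obtain ⟨E, hE⟩ := exists_isDisintegration X₂.space.P n.2.measurable
  have := hD.markov
  have := hE.markov
  rw [indep_iff_setLIntegral _ _ _ _ hD] at hA
  rw [indep_iff_setLIntegral _ _ _ _ hE] at hB
  refine (indep_iff_setLIntegral _ _ _ _ hE).2 ⟨homMk_eq_iff.1 hc, fun S T hS hT => ?_⟩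
  have hcT := c.2.measurable hT
  have key : (fun y => D y (c.1 ⁻¹' T)) =ᵐ[Y₁.space.P] fun y => E (d.1 y) T := by
    refine ae_eq_of_forall_setLIntegral_eq_of_sigmaFinite (D.measurable_coe hcT)
      ((E.measurable_coe hT).comp d.2.measurable) fun V hV _ => ?_
    rw [← hB.2 V T hV hT, ← hD.setLIntegral m.2.measurable hV hcT, m.2.map_eq]
  exact (hA.2 S _ hS hcT).trans
    (lintegral_congr_ae (ae_restrict_of_ae (b.2.quasiMeasurePreserving.ae key)))

/-- The legs of an independent pullback determine the points of its vertex. -/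
theorem exists_leftInverse (hsp : ContainsEverySBPS sp) {X Y Z W : SBP₀ sp}
    (p : SBPS.Map X.space Y.space) (q : SBPS.Map X.space Z.space) {u : Y ⟶ W} {v : Z ⟶ W}
    (h : (indepSquares sp).IsIndependentPullback (homMk p) (homMk q) u v) :
    ∃ k : Y.space × Z.space → X.space, Measurable k ∧
      ∀ᵐ x ∂X.space.P, k (p.1 x, q.1 x) = x := by
  obtain ⟨r, rfl⟩ := exists_homMk u
  obtain ⟨s, rfl⟩ := exists_homMk v
  obtain ⟨D, hD⟩ := exists_isDisintegration Y.space.P r.2.measurable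
  obtain ⟨E, hE⟩ := exists_isDisintegration Z.space.P s.2.measurable
  have := hD.markov
  have := hE.markov
  obtain ⟨i, ⟨e⟩⟩ := hsp (SBPS.condProd D E)
  have h' := condProd_isIndependentPullback r s D E hD hE ⟨i⟩ e.symm
  -- Two independent pullbacks of one cospan are compared. In the conditional product, a point is
  -- its pair of coordinates, so `k` is a function of that pair.
  obtain ⟨j, ⟨hj₁, hj₂⟩, -⟩ := h'.2 _ _ _ h.1
  obtain ⟨k, ⟨hk₁, hk₂⟩, -⟩ := h.2 _ _ _ h'.1
  have hjk : j ≫ k = 𝟙 X := by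
    refine (h.2 _ _ _ h.1).unique ⟨?_, ?_⟩ ⟨Category.id_comp _, Category.id_comp _⟩
    · rw [Category.assoc, hk₁, hj₁]
    · rw [Category.assoc, hk₂, hj₂]
  obtain ⟨j, rfl⟩ := exists_homMk j
  obtain ⟨k, rfl⟩ := exists_homMk k
  refine ⟨k.1 ∘ e.1, k.2.measurable.comp e.1.measurable, ?_⟩
  filter_upwards [homMk_eq_iff.1 hj₁, homMk_eq_iff.1 hj₂, homMk_eq_iff.1 hjk] with x h1 h2 h3
  have h4 : e.1.symm (j.1 x) = (p.1 x, q.1 x) := Prod.ext h1 h2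
  have h5 : e.1 (p.1 x, q.1 x) = j.1 x := by
    rw [← h4]
    exact e.1.apply_symm_apply _
  exact (congrArg k.1 h5).trans h3

/-- Joint laws of independent squares over the same cospan agree. -/
theorem map_eq_of_indep {X X' Y Z W : SBP₀ sp}
    {p : SBPS.Map X.space Y.space} {q : SBPS.Map X.space Z.space}
    {p' : SBPS.Map X'.space Y.space} {q' : SBPS.Map X'.space Z.space} {u : Y ⟶ W} {v : Z ⟶ W}
    (h : (indepSquares sp).Indep (homMk p) (homMk q) u v)
    (h' : (indepSquares sp).Indep (homMk p') (homMk q') u v) :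
    X.space.P.map (fun x => (p.1 x, q.1 x)) = X'.space.P.map (fun x => (p'.1 x, q'.1 x)) := by
  obtain ⟨r, rfl⟩ := exists_homMk u
  obtain ⟨s, rfl⟩ := exists_homMk v
  obtain ⟨E, hE⟩ := exists_isDisintegration Z.space.P s.2.measurable
  have := hE.markov
  exact ((indep_iff_compProd _ _ _ _ hE).1 h).2.trans
    ((indep_iff_compProd _ _ _ _ hE).1 h').2.symm

/-- A commuting square with the joint law of an independent square is independent. -/
theorem indep_of_map_eq {X X' Y Z W : SBP₀ sp}
    {p : SBPS.Map X.space Y.space} {q : SBPS.Map X.space Z.space}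
    {p' : SBPS.Map X'.space Y.space} {q' : SBPS.Map X'.space Z.space} {u : Y ⟶ W} {v : Z ⟶ W}
    (hc : homMk p ≫ u = homMk q ≫ v)
    (h : X.space.P.map (fun x => (p.1 x, q.1 x)) = X'.space.P.map (fun x => (p'.1 x, q'.1 x)))
    (h' : (indepSquares sp).Indep (homMk p') (homMk q') u v) :
    (indepSquares sp).Indep (homMk p) (homMk q) u v := by
  obtain ⟨r, rfl⟩ := exists_homMk u
  obtain ⟨s, rfl⟩ := exists_homMk v
  obtain ⟨E, hE⟩ := exists_isDisintegration Z.space.P s.2.measurable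
  have := hE.markov
  exact (indep_iff_compProd _ _ _ _ hE).2
    ⟨homMk_eq_iff.1 hc, h.trans ((indep_iff_compProd _ _ _ _ hE).1 h').2⟩

/-- Law comparison with an independent pullback `X'` of `b` and `m`: pasted with (B), it has the
same joint law over `Y` and `X₂` as the given rectangle, and that law determines the one over `Y`
and `X₁`. -/
theorem indep_of_paste (hsp : ContainsEverySBPS sp) {X X₁ X₂ Y Y₁ Y₂ : SBP₀ sp} {a : X ⟶ X₁}
    {c : X₁ ⟶ X₂} {l : X ⟶ Y} {m : X₁ ⟶ Y₁} {n : X₂ ⟶ Y₂} {b : Y ⟶ Y₁} {d : Y₁ ⟶ Y₂}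
    (hA : l ≫ b = a ≫ m) (hAB : (indepSquares sp).Indep l (a ≫ c) (b ≫ d) n)
    (hB : (indepSquares sp).IsIndependentPullback m c d n) :
    (indepSquares sp).Indep l a b m := by
  obtain ⟨X', l', a', hA', -⟩ := exists_isIndependentPullback hsp b m
  have hAB' := indep_paste hA' hB.1
  have hc' := (indepSquares sp).comm hA'
  obtain ⟨a, rfl⟩ := exists_homMk a
  obtain ⟨b, rfl⟩ := exists_homMk b
  obtain ⟨c, rfl⟩ := exists_homMk c
  obtain ⟨l, rfl⟩ := exists_homMk l
  obtain ⟨m, rfl⟩ := exists_homMk m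
  obtain ⟨l', rfl⟩ := exists_homMk l'
  obtain ⟨a', rfl⟩ := exists_homMk a'
  obtain ⟨k, hk, hkx⟩ := exists_leftInverse hsp m c hB
  rw [homMk_comp] at hAB hAB'
  have hlaw := map_eq_of_indep hAB hAB'
  have hφ : Measurable fun z : Y.space × X₂.space => (z.1, k (b.1 z.1, z.2)) :=
    measurable_fst.prodMk
      (hk.comp ((b.2.measurable.comp measurable_fst).prodMk measurable_snd))
  -- Since `m ∘ a = b ∘ l` almost surely, `a` equals `k (b ∘ l, c ∘ a)`. The map applied to the law
  -- is the same for every `T`, hence for `X` and for `X'`.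
  have recover : ∀ {T : SBP₀ sp} (l : SBPS.Map T.space Y.space) (a : SBPS.Map T.space X₁.space),
      (homMk l : T ⟶ Y) ≫ (homMk b : Y ⟶ Y₁) = (homMk a : T ⟶ X₁) ≫ (homMk m : X₁ ⟶ Y₁) →
      T.space.P.map (fun x => (l.1 x, a.1 x)) =
        (T.space.P.map fun x => (l.1 x, (c.comp a).1 x)).map
          fun z => (z.1, k (b.1 z.1, z.2)) := by
    intro T l a hc
    rw [Measure.map_map hφ (l.2.measurable.prodMk (c.comp a).2.measurable)]
    refine Measure.map_congr ?_
    filter_upwards [homMk_eq_iff.1 hc, a.2.quasiMeasurePreserving.ae hkx] with x h1 h2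
    have h1 : b.1 (l.1 x) = m.1 (a.1 x) := h1
    refine Prod.ext rfl ?_
    change a.1 x = k (b.1 (l.1 x), c.1 (a.1 x))
    rw [h1, h2]
  refine indep_of_map_eq hA ?_ hA'
  rw [recover l a hA, recover l' a' hc', hlaw]

theorem indepSquares_isIndependentPullbackStructure (hsp : ContainsEverySBPS sp) :
    (indepSquares sp).IsIndependentPullbackStructure where
  ip1 := indep_of_id
  ip2 _ _ _ _ := indep_symm
  ip3 _ _ _ _ _ _ _ := indep_paste
  ip4 _ _ _ _ _ _ _ := indep_of_paste hsp
  ip5 := exists_isIndependentPullback hsp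

end SBP₀

theorem proposition8p4 {ι : Type w} (sp : ι → SBPS.{u}) (hsp : ContainsEverySBPS sp) :
    -- independence of a square does not depend on the representatives of its maps
    (∀ {X Y Z W : SBP₀ sp} (p : SBPS.Map X.space Y.space) (q : SBPS.Map X.space Z.space)
      (r : SBPS.Map Y.space W.space) (s : SBPS.Map Z.space W.space),
      (SBP₀.indepSquares sp).Indep (SBP₀.homMk p) (SBP₀.homMk q) (SBP₀.homMk r) (SBP₀.homMk s) ↔
        (r.1 ∘ p.1 =ᵐ[X.space.P] s.1 ∘ q.1 ∧
          CondIndepRV X.space.P p.1 q.1 (r.1 ∘ p.1))) ∧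
    -- independent pullback structure, with the descent property
    (SBP₀.indepSquares sp).IsIndependentPullbackStructure ∧
    (SBP₀.indepSquares sp).HasDescent ∧
    -- independent pullbacks are given by conditional products
    (∀ {Y Z W : SBP₀ sp} (r : SBPS.Map Y.space W.space) (s : SBPS.Map Z.space W.space)
      (D : Kernel W.space Y.space) (E : Kernel W.space Z.space)
      [IsMarkovKernel D] [IsMarkovKernel E]
      (hD : IsDisintegration Y.space.P r.1 D) (hE : IsDisintegration Z.space.P s.1 E)
      (X : SBP₀ sp) (e : SBPS.Iso X.space (SBPS.condProd D E)),
      (SBP₀.indepSquares sp).IsIndependentPullback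
        (SBP₀.homMk ((SBPS.condProdFst r E hD).comp e.toMap) : X ⟶ Y)
        (SBP₀.homMk ((SBPS.condProdSnd s D hE).comp e.toMap) : X ⟶ Z)
        (SBP₀.homMk r) (SBP₀.homMk s)) ∧
    -- pairings exist, and are given by joint laws
    HasPairings (SBP₀ sp) ∧
    (∀ {X Y Z : SBP₀ sp} (p : SBPS.Map X.space Y.space) (q : SBPS.Map X.space Z.space)
      (X' : SBP₀ sp) (e : SBPS.Iso X'.space (SBPS.jointLaw p q)),
      ∃ (h₁ : (SBP₀.homMk (e.invMap.comp (SBPS.jointMap p q)) : X ⟶ X') ≫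
            (SBP₀.homMk ((SBPS.jointFst p q).comp e.toMap) : X' ⟶ Y) = SBP₀.homMk p)
        (h₂ : (SBP₀.homMk (e.invMap.comp (SBPS.jointMap p q)) : X ⟶ X') ≫
            (SBP₀.homMk ((SBPS.jointSnd p q).comp e.toMap) : X' ⟶ Z) = SBP₀.homMk q),
        PairFactorisation.IsPairing ⟨X', _, _, _, h₁, h₂⟩) :=
  ⟨SBP₀.indep_homMk_iff, SBP₀.indepSquares_isIndependentPullbackStructure hsp,
    SBP₀.indepSquares_hasDescent, SBP₀.condProd_isIndependentPullback, SBP₀.hasPairings hsp,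
    SBP₀.jointLaw_isPairing⟩
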